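/- Call a category finitely concrete if it admits a faithful functor into the category $\mathbf{Set}$ of sets that preserves directed colimits (colimits of small diagrams indexed by nonempty directed posets). Let $\mathbf{Hilb}_r$ be the category of complex Hilbert spaces with (not necessarily surjective) linear isometries. Then the following hold. (1) None of the following five categories is finitely concrete: the category $\mathbf{Met}_r$ of complete metric spaces with (not necessarily surjective) isometries; the category $\mathbf{Ban}_r$ of complex Banach spaces with (not necessarily surjective) linear isometries; the category $\mathbf{Hilb}$ of complex Hilbert spaces with linear contractions (linear maps $f$ with $\|f(x)\|\le\|x\|$ for all $x$); the category $\mathbf{Met}$ of complete metric spaces with contractions (maps $f$ with $d(f(x),f(y))\le d(x,y)$ for all $x,y$); the category $\mathbf{Ban}$ of complex Banach spaces with linear contractions. (2) Each of the natural inclusion functors from $\mathbf{Hilb}_r$ into $\mathbf{Met}_r$, $\mathbf{Ban}_r$, $\mathbf{Hilb}$, $\mathbf{Met}$ and $\mathbf{Ban}$ is faithful and preserves directed colimits. (3) More generally, if $F:\mathcal K\to\mathcal K^\ast$ is a faithful functor that preserves directed colimits (for example, the inclusion of a subcategory closed under directed colimits) and $\mathcal K$ is not finitely concrete, then $\mathcal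 K^\ast$ is not finitely concrete. -/

import Mathlib

open CategoryTheory CategoryTheory.Limits

universe u v₁ w₁ v₂ w₂

namespace FiniteConcreteness

/-! ### Finitely concrete categories -/

/-- `F` preserves (small) directed colimits: colimits of diagrams indexed by nonempty directed
partially ordered sets. -/
def PreservesDirectedColimits.{s, a₁, b₁, a₂, b₂} {C : Type a₁} [Category.{b₁} C]
    {D : Type a₂} [Category.{b₂} D] (F : C ⥤ D) : Prop :=
  ∀ (J : Type s) [PartialOrder J] [IsDirectedOrder J] [Nonempty J], PreservesColimitsOfShape J F

/-- A category is finitely concrete if it admits a faithful functor into the category of sets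
which preserves directed colimits. -/
def IsFinitelyConcrete.{s, a, b} (C : Type a) [Category.{b} C] : Prop :=
  ∃ U : C ⥤ Type s, U.Faithful ∧ PreservesDirectedColimits.{s} U

/-! ### Objects and morphisms -/

/-- Linear contractions: linear maps `f` with `‖f x‖ ≤ ‖x‖` for all `x`. -/
@[ext]
structure LinearContraction (E : Type v₁) (F : Type v₂) [NormedAddCommGroup E] [NormedSpace ℂ E]
    [NormedAddCommGroup F] [NormedSpace ℂ F] where
  toLinearMap : E →ₗ[ℂ] F
  norm_map_le : ∀ x, ‖toLinearMap x‖ ≤ ‖x‖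

/-- `Hilb_r`: complex Hilbert spaces, with (not necessarily surjective) linear isometries. -/
structure HilbR : Type (u + 1) where
  of ::
  carrier : Type u
  [normed : NormedAddCommGroup carrier]
  [inner : InnerProductSpace ℂ carrier]
  [complete : CompleteSpace carrier]

/-- `Hilb`: complex Hilbert spaces, with linear contractions. -/
structure Hilb : Type (u + 1) where
  of ::
  carrier : Type u
  [normed : NormedAddCommGroup carrier]
  [inner : InnerProductSpace ℂ carrier]
  [complete : CompleteSpace carrier]

/-- `Ban_r`: complex Banach spaces, with (not necessarily surjective) linear isometries. -/
structure BanR : Type (u + 1) where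
  of ::
  carrier : Type u
  [normed : NormedAddCommGroup carrier]
  [space : NormedSpace ℂ carrier]
  [complete : CompleteSpace carrier]

/-- `Ban`: complex Banach spaces, with linear contractions. -/
structure Ban : Type (u + 1) where
  of ::
  carrier : Type u
  [normed : NormedAddCommGroup carrier]
  [space : NormedSpace ℂ carrier]
  [complete : CompleteSpace carrier]

/-- `Met_r`: complete metric spaces, with (not necessarily surjective) isometries. -/
structure MetR : Type (u + 1) where
  of ::
  carrier : Type u
  [metric : MetricSpace carrier]
  [complete : CompleteSpace carrier]

/-- `Met`: complete metric spaces, with contractions (maps which do not increase distances). -/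
structure Met : Type (u + 1) where
  of ::
  carrier : Type u
  [metric : MetricSpace carrier]
  [complete : CompleteSpace carrier]

attribute [instance] HilbR.normed HilbR.inner HilbR.complete Hilb.normed Hilb.inner Hilb.complete
  BanR.normed BanR.space BanR.complete Ban.normed Ban.space Ban.complete
  MetR.metric MetR.complete Met.metric Met.complete

/-- Morphisms of `Hilb_r`. -/
@[ext]
structure HilbR.Hom (A B : HilbR.{u}) : Type u where
  hom : A.carrier →ₗᵢ[ℂ] B.carrier

/-- Morphisms of `Hilb`. -/
@[ext]
structure Hilb.Hom (A B : Hilb.{u}) : Type u where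
  hom : LinearContraction A.carrier B.carrier

/-- Morphisms of `Ban_r`. -/
@[ext]
structure BanR.Hom (A B : BanR.{u}) : Type u where
  hom : A.carrier →ₗᵢ[ℂ] B.carrier

/-- Morphisms of `Ban`. -/
@[ext]
structure Ban.Hom (A B : Ban.{u}) : Type u where
  hom : LinearContraction A.carrier B.carrier

/-- Morphisms of `Met_r`. -/
@[ext]
structure MetR.Hom (A B : MetR.{u}) : Type u where
  hom : A.carrier → B.carrier
  isometry : Isometry hom

/-- Morphisms of `Met`. -/
@[ext]
structure Met.Hom (A B : Met.{u}) : Type u where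
  hom : A.carrier → B.carrier
  dist_map_le : ∀ x y, dist (hom x) (hom y) ≤ dist x y

namespace LinearContraction

variable {E : Type v₁} {F : Type v₂} {G : Type w₁}
  [NormedAddCommGroup E] [NormedSpace ℂ E] [NormedAddCommGroup F] [NormedSpace ℂ F]
  [NormedAddCommGroup G] [NormedSpace ℂ G]

/-- The identity. -/
def id (E : Type v₁) [NormedAddCommGroup E] [NormedSpace ℂ E] : LinearContraction E E where
  toLinearMap := LinearMap.id
  norm_map_le _ := le_rfl

/-- The composite `g ∘ f`. -/
def comp (g : LinearContraction F G) (f : LinearContraction E F) : LinearContraction E G where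
  toLinearMap := g.toLinearMap.comp f.toLinearMap
  norm_map_le x := (g.norm_map_le _).trans (f.norm_map_le x)

/-- A linear isometry is a linear contraction. -/
def ofIsometry (f : E →ₗᵢ[ℂ] F) : LinearContraction E F where
  toLinearMap := f.toLinearMap
  norm_map_le x := (f.norm_map x).le

end LinearContraction

/-! ### The categories -/

instance : LargeCategory.{u} HilbR.{u} where
  Hom A B := HilbR.Hom A B
  id _ := ⟨LinearIsometry.id⟩
  comp f g := ⟨g.hom.comp f.hom⟩

instance : LargeCategory.{u} Hilb.{u} where
  Hom A B := Hilb.Hom A B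
  id A := ⟨LinearContraction.id A.carrier⟩
  comp f g := ⟨g.hom.comp f.hom⟩

instance : LargeCategory.{u} BanR.{u} where
  Hom A B := BanR.Hom A B
  id _ := ⟨LinearIsometry.id⟩
  comp f g := ⟨g.hom.comp f.hom⟩

instance : LargeCategory.{u} Ban.{u} where
  Hom A B := Ban.Hom A B
  id A := ⟨LinearContraction.id A.carrier⟩
  comp f g := ⟨g.hom.comp f.hom⟩

instance : LargeCategory.{u} MetR.{u} where
  Hom A B := MetR.Hom A B
  id _ := ⟨fun x => x, isometry_id⟩
  comp f g := ⟨fun x => g.hom (f.hom x), g.isometry.comp f.isometry⟩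

instance : LargeCategory.{u} Met.{u} where
  Hom A B := Met.Hom A B
  id _ := ⟨fun x => x, fun _ _ => le_rfl⟩
  comp f g := ⟨fun x => g.hom (f.hom x),
    fun x y => (g.dist_map_le _ _).trans (f.dist_map_le x y)⟩

/-! ### The natural inclusions of `Hilb_r` -/

/-- The inclusion `Hilb_r → Met_r`. -/
def hilbRToMetR : HilbR.{u} ⥤ MetR.{u} where
  obj A := MetR.of A.carrier
  map f := ⟨f.hom, f.hom.isometry⟩

/-- The inclusion `Hilb_r → Ban_r`. -/
def hilbRToBanR : HilbR.{u} ⥤ BanR.{u} where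
  obj A := BanR.of A.carrier
  map f := ⟨f.hom⟩

/-- The inclusion `Hilb_r → Hilb`. -/
def hilbRToHilb : HilbR.{u} ⥤ Hilb.{u} where
  obj A := Hilb.of A.carrier
  map f := ⟨LinearContraction.ofIsometry f.hom⟩

/-- The inclusion `Hilb_r → Met`. -/
def hilbRToMet : HilbR.{u} ⥤ Met.{u} where
  obj A := Met.of A.carrier
  map f := ⟨f.hom, fun x y => (f.hom.dist_map x y).le⟩

/-- The inclusion `Hilb_r → Ban`. -/
def hilbRToBan : HilbR.{u} ⥤ Ban.{u} where
  obj A := Ban.of A.carrier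
  map f := ⟨LinearContraction.ofIsometry f.hom⟩

end FiniteConcreteness

/-! If `F` is faithful and preserves directed colimits, composing it with a functor witnessing
finite concreteness of its target gives a witness for its source. Everything therefore reduces to
two facts: `Hilb_r` is not finitely concrete, and its inclusions are faithful and preserve directed
colimits.

For the inclusions, the legs of a directed colimit in `Hilb_r` are jointly dense
(`denseRange_legs`), and a cocone with jointly dense isometric legs is a colimit in all the
categories, by extension by continuity.

For `Hilb_r`, let `U` preserve directed colimits, let `H` be ℓ², and let `x ∈ U H`. Writing `H` as a
colimit of a chain of finite-dimensional subspaces shows that `x` is supported on some member `A`: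
isometries fixing `A` pointwise fix `x` (`exists_support`). Let `P v` say that the reflection
negating the unit vector `v` fixes `x`. Householder maps show that `P` is unchanged under moves
between unit vectors with difference orthogonal to `A`. With two independent supports `A`, `B` and
`v ∉ A + B`, every unit vector near `v` is reached by one move for each
(`eventually_exists_sub_orthogonal`). So `P` is locally constant on the connected unit sphere, and
it holds at unit vectors orthogonal to `A`. Hence `U` sends every such reflection to the identity
and is not faithful. -/

namespace FiniteConcreteness

open Topology Filter
open scoped InnerProductSpace

/-! ### Geometry of unit vectors with prescribed components -/

section Hilbert

variable {H : Type*} [NormedAddCommGroup H] [InnerProductSpace ℂ H]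

/-- This identity is what makes the Householder map below isometric. -/
lemma two_mul_re_inner_sub_eq {p q : H} (h : ‖p‖ = ‖q‖) :
    2 * (⟪p - q, p⟫_ℂ).re = ‖p - q‖ ^ 2 := by
  have h1 := @norm_sub_sq ℂ H _ _ _ p q
  have h2 : (⟪p, q⟫_ℂ).re = (⟪q, p⟫_ℂ).re := by
    have := @inner_re_symm ℂ H _ _ _ p q
    simpa using this
  have h3 : (⟪p, p⟫_ℂ).re = ‖p‖ ^ 2 := by
    have := @inner_self_eq_norm_sq ℂ H _ _ _ p
    simpa using this
  simp only [RCLike.re_eq_complex_re] at h1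
  rw [inner_sub_left, Complex.sub_re, h3, h1, h2, ← h]
  ring

/-- The complex Householder transformation carrying `p` to `q`, which fixes every vector
orthogonal to `p - q`. -/
lemma exists_linearIsometry_map_eq {p q : H} (h : ‖p‖ = ‖q‖) :
    ∃ g : H →ₗᵢ[ℂ] H, g p = q ∧ ∀ x, ⟪p - q, x⟫_ℂ = 0 → g x = x := by
  have key := two_mul_re_inner_sub_eq h
  set a := p - q with ha
  set s := ⟪a, p⟫_ℂ with hs
  refine ⟨⟨LinearMap.id - s⁻¹ • ((innerₛₗ ℂ a).smulRight a), ?_⟩, ?_, ?_⟩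
  · intro x
    simp only [LinearMap.sub_apply, LinearMap.id_apply, LinearMap.smul_apply,
      LinearMap.smulRight_apply, innerₛₗ_apply_apply]
    rw [← sq_eq_sq₀ (norm_nonneg _) (norm_nonneg _)]
    have h1 := @norm_sub_sq ℂ H _ _ _ x (s⁻¹ • ⟪a, x⟫_ℂ • a)
    rw [h1, inner_smul_right, inner_smul_right, norm_smul, norm_smul, norm_inv]
    have h2 : ⟪a, x⟫_ℂ * ⟪x, a⟫_ℂ = ((‖⟪a, x⟫_ℂ‖ ^ 2 : ℝ) : ℂ) := by
      rw [← inner_conj_symm x a, Complex.mul_conj, Complex.normSq_eq_norm_sq]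
    rw [h2, RCLike.re_eq_complex_re, Complex.re_mul_ofReal, Complex.inv_re,
      Complex.normSq_eq_norm_sq]
    have h3 : s.re = ‖a‖ ^ 2 / 2 := by linarith
    rw [h3]
    by_cases h0 : ‖s‖ = 0
    · simp [h0]
    · field_simp
      ring
  · change p - s⁻¹ • ⟪a, p⟫_ℂ • a = q
    rw [← hs, smul_smul]
    -- When `s = 0` the identity `key` forces `p = q`; the convention `0⁻¹ = 0` then makes the map
    -- the identity.
    by_cases h0 : s = 0
    · have : a = 0 := by
        rw [h0] at key
        simpa using key.symm
      rw [this]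
      have : p = q := by rwa [ha, sub_eq_zero] at this
      simp [this]
    · rw [inv_mul_cancel₀ h0, ha]
      simp
  · intro x hx
    change x - s⁻¹ • ⟪a, x⟫_ℂ • a = x
    simp [hx]

lemma reflection_map_linearIsometry (g : H →ₗᵢ[ℂ] H) (v x : H) :
    (ℂ ∙ g v)ᗮ.reflection (g x) = g ((ℂ ∙ v)ᗮ.reflection x) := by
  simp [Submodule.reflection_orthogonal_apply, Submodule.reflection_singleton_apply]

variable [CompleteSpace H]

/-- Prescribing the components of a unit vector in two independent finite-dimensional subspaces,
close to those of a unit vector outside their sum. -/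
lemma eventually_exists_sub_orthogonal {G G' : Submodule ℂ H} [FiniteDimensional ℂ G]
    [FiniteDimensional ℂ G'] (hd : Disjoint G G') {v : H} (hv : v ∉ G ⊔ G') (hv1 : ‖v‖ = 1) :
    ∀ᶠ u in 𝓝 v, ∃ w : H, ‖w‖ = 1 ∧ (∀ g ∈ G, ⟪v - w, g⟫_ℂ = 0) ∧
      ∀ g ∈ G', ⟪w - u, g⟫_ℂ = 0 := by
  set T := G ⊔ G' with hT
  obtain ⟨C, hG'C, hC⟩ := hd.symm.exists_isCompl
  -- On `T = G ⊕ G'` this is the projection onto `G'` along `G`; `Q` extends it by zero on `Tᗮ`.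
  let Q₀ : T →L[ℂ] H := LinearMap.toContinuousLinearMap
    (C.projection G hC ∘ₗ T.subtype)
  let Q : H →L[ℂ] H := Q₀ ∘L T.orthogonalProjectionOnto
  have hQ : ∀ g ∈ T, Q g = C.projection G hC g := by
    intro g hg
    simp [Q, Q₀, Submodule.starProjection_eq_self_iff.2 hg]
  have hQG : ∀ g ∈ G, Q g = 0 := fun g hg => by
    rw [hQ g (le_sup_left (a := G) hg)]
    exact (Submodule.projection_apply_eq_zero_iff _).2 hg
  have hQG' : ∀ g ∈ G', Q g = g := fun g hg => by
    rw [hQ g (le_sup_right (a := G) hg)]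
    exact (Submodule.projection_eq_self_iff _ _).2 (hG'C hg)
  have hQT : ∀ z ∈ Tᗮ, Q z = 0 := fun z hz => by
    simp [Q, Submodule.orthogonalProjectionOnto_apply_of_mem_orthogonal hz]
  -- Since `⟪δ u, g⟫ = ⟪u - v, Q g⟫`, adding `δ u` keeps the component of `v` along `G` and changes
  -- the one along `G'` to that of `u`.
  let δ : H → H := fun u => ContinuousLinearMap.adjoint Q (u - v)
  have hδT : ∀ u, δ u ∈ T := by
    intro u
    rw [← T.orthogonal_orthogonal]
    intro z hz
    rw [ContinuousLinearMap.adjoint_inner_right, hQT z hz, inner_zero_left]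
  let v₁ := T.starProjection v
  have hv₁ : v₁ ∈ T := by simp [v₁]
  have hv₂ : v - v₁ ∈ Tᗮ := by simp [v₁]
  have hv0 : v - v₁ ≠ 0 := fun h => hv (by rw [sub_eq_zero.1 h]; exact hv₁)
  have hlt : ‖v₁ + δ v‖ < 1 := by
    have h1 : ‖v‖ * ‖v‖ = ‖v₁‖ * ‖v₁‖ + ‖v - v₁‖ * ‖v - v₁‖ := by
      have := norm_add_sq_eq_norm_sq_add_norm_sq_of_inner_eq_zero v₁ (v - v₁) (𝕜 := ℂ)
        (hv₂ _ hv₁)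
      simpa using this
    have h2 : 0 < ‖v - v₁‖ := norm_pos_iff.2 hv0
    simp only [δ, sub_self, map_zero, add_zero]
    rw [hv1] at h1
    nlinarith [norm_nonneg v₁]
  have hcont : Continuous fun u => ‖v₁ + δ u‖ := by fun_prop
  filter_upwards [hcont.continuousAt.eventually_lt continuousAt_const hlt] with u hu
  set t := v₁ + δ u with ht
  have htT : t ∈ T := T.add_mem hv₁ (hδT u)
  -- A vector of `Tᗮ` that restores norm one without affecting components along `T`; it exists
  -- because `‖t‖ < 1`.
  set z : H := ((√(1 - ‖t‖ ^ 2) / ‖v - v₁‖ : ℝ) : ℂ) • (v - v₁) with hz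
  have hzT : z ∈ Tᗮ := Tᗮ.smul_mem _ hv₂
  have hzn : ‖z‖ = √(1 - ‖t‖ ^ 2) := by
    rw [hz, norm_smul, Complex.norm_real, Real.norm_eq_abs, abs_of_nonneg (by positivity)]
    field_simp
  have hin : ∀ g ∈ T, ⟪v - (t + z), g⟫_ℂ = - ⟪δ u, g⟫_ℂ := by
    intro g hg
    have e : v - (t + z) = (v - v₁) - δ u - z := by rw [ht]; abel
    rw [e, inner_sub_left, inner_sub_left, Submodule.inner_left_of_mem_orthogonal hg hv₂,
      Submodule.inner_left_of_mem_orthogonal hg hzT]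
    simp
  refine ⟨t + z, ?_, ?_, ?_⟩
  · have := norm_add_sq_eq_norm_sq_add_norm_sq_of_inner_eq_zero t z (𝕜 := ℂ) (hzT _ htT)
    rw [hzn, Real.mul_self_sqrt (by nlinarith [norm_nonneg t])] at this
    rw [← sq_eq_sq₀ (norm_nonneg _) zero_le_one]
    linarith
  · intro g hg
    rw [hin g (le_sup_left (a := G) hg), ContinuousLinearMap.adjoint_inner_left, hQG g hg]
    simp
  · intro g hg
    have e : t + z - u = -(u - v) - (v - (t + z)) := by abel
    rw [e, inner_sub_left, hin g (le_sup_right (a := G) hg),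
      ContinuousLinearMap.adjoint_inner_left, hQG' g hg, inner_neg_left]
    simp

end Hilbert

/-! ### Independent chains of finite-dimensional subspaces -/

section Chains

variable {H : Type*} [NormedAddCommGroup H] [InnerProductSpace ℂ H]

lemma exists_notMem_norm_sub_lt {S : Submodule ℂ H} (hS : S ≠ ⊤) (d : H) {ε : ℝ} (hε : 0 < ε) :
    ∃ c, c ∉ S ∧ ‖c - d‖ < ε := by
  by_cases hd : d ∈ S
  · obtain ⟨z, -, hz⟩ := SetLike.exists_of_lt (lt_top_iff_ne_top.2 hS)
    have hz0 : z ≠ 0 := fun h => hz (h ▸ S.zero_mem)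
    have hzn : 0 < ‖z‖ := norm_pos_iff.2 hz0
    have ht : 0 < ε / (2 * ‖z‖) := by positivity
    refine ⟨d + ((ε / (2 * ‖z‖) : ℝ) : ℂ) • z, fun h => hz ?_, ?_⟩
    · rw [S.add_mem_iff_right hd] at h
      exact (S.smul_mem_iff (by exact_mod_cast ht.ne')).1 h
    · rw [add_sub_cancel_left, norm_smul, Complex.norm_real, Real.norm_eq_abs, abs_of_pos ht]
      field_simp
      linarith
  · exact ⟨d, hd, by simpa using hε⟩

/-- Independent finite-dimensional subspaces whose sum does not contain `v`. -/
structure IndependentPair (v : H) (A B : Submodule ℂ H) : Prop where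
  finite_left : FiniteDimensional ℂ A
  finite_right : FiniteDimensional ℂ B
  disjoint : Disjoint A B
  notMem : v ∉ A ⊔ B

lemma IndependentPair.symm {v : H} {A B : Submodule ℂ H} (h : IndependentPair v A B) :
    IndependentPair v B A :=
  ⟨h.finite_right, h.finite_left, h.disjoint.symm, sup_comm A B ▸ h.notMem⟩

/-- The complement of the proper subspace `A + B + ℂ v` is dense, so `d` can be perturbed slightly
to a vector outside it; adjoining that vector to `A` preserves independence and still avoids `v`. -/
lemma IndependentPair.exists_extend_left (hH : ¬ FiniteDimensional ℂ H) {v : H}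
    {A B : Submodule ℂ H} (h : IndependentPair v A B) (d : H) {ε : ℝ} (hε : 0 < ε) :
    ∃ A', A ≤ A' ∧ IndependentPair v A' B ∧ ∃ c ∈ A', ‖c - d‖ < ε := by
  have := h.finite_left
  have := h.finite_right
  have hne : A ⊔ B ⊔ ℂ ∙ v ≠ ⊤ := fun e => hH (Module.finite_def.2
    (e ▸ (Submodule.fg_iff_finiteDimensional _).2 inferInstance))
  obtain ⟨c, hc, hcd⟩ := exists_notMem_norm_sub_lt hne d hε
  have hdc : Disjoint (A ⊔ B) (ℂ ∙ c) :=
    Submodule.disjoint_span_singleton_of_notMem fun h => hc (Submodule.mem_sup_left h)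
  refine ⟨A ⊔ ℂ ∙ c, le_sup_left, ⟨inferInstance, inferInstance, ?_, fun hv => ?_⟩, c,
    Submodule.mem_sup_right (Submodule.mem_span_singleton_self c), hcd⟩
  · have h1 : Disjoint B (A ⊔ ℂ ∙ c) :=
      Disjoint.disjoint_sup_right_of_disjoint_sup_left h.disjoint.symm (sup_comm A B ▸ hdc)
    exact h1.symm
  · rw [sup_right_comm, Submodule.mem_sup] at hv
    obtain ⟨y, hy, z, hz, hyz⟩ := hv
    obtain ⟨t, rfl⟩ := Submodule.mem_span_singleton.1 hz
    have ht : t ≠ 0 := by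
      rintro rfl
      exact h.notMem (by simpa [← hyz] using hy)
    have hmem : t • c ∈ A ⊔ B ⊔ ℂ ∙ v := by
      rw [show t • c = v - y from eq_sub_of_add_eq' hyz]
      exact Submodule.sub_mem _ (Submodule.mem_sup_right (Submodule.mem_span_singleton_self v))
        (Submodule.mem_sup_left hy)
    exact hc ((Submodule.smul_mem_iff _ ht).1 hmem)

/-- Two independent increasing sequences of finite-dimensional subspaces with dense unions, whose
sum avoids a given nonzero vector. -/
lemma exists_independentPair_chains (hH : ¬ FiniteDimensional ℂ H) (b : ℕ → H)
    (hb : (Submodule.span ℂ (Set.range b)).topologicalClosure = ⊤) {v : H} (hv : v ≠ 0) :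
    ∃ A B : ℕ →o Submodule ℂ H, (∀ n, IndependentPair v (A n) (B n)) ∧
      Dense (⋃ n, (A n : Set H)) ∧ Dense (⋃ n, (B n : Set H)) := by
  -- Unpairing makes each `b k` a target infinitely often, at the stages `Nat.pair k N`, where the
  -- tolerance is at most `1 / (N + 1)`.
  have step : ∀ (n : ℕ) (p : {p : Submodule ℂ H × Submodule ℂ H // IndependentPair v p.1 p.2}),
      ∃ q : {p : Submodule ℂ H × Submodule ℂ H // IndependentPair v p.1 p.2}, p.1 ≤ q.1 ∧
        (∃ c ∈ q.1.1, ‖c - b n.unpair.1‖ < 1 / (n + 1)) ∧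
        ∃ c ∈ q.1.2, ‖c - b n.unpair.1‖ < 1 / (n + 1) := by
    rintro n ⟨⟨A, B⟩, h⟩
    obtain ⟨A', hA, hA', hcA⟩ := h.exists_extend_left hH (b n.unpair.1)
      (Nat.one_div_pos_of_nat (α := ℝ) (n := n))
    obtain ⟨B', hB, hB', hcB⟩ := hA'.symm.exists_extend_left hH (b n.unpair.1)
      (Nat.one_div_pos_of_nat (α := ℝ) (n := n))
    exact ⟨⟨(A', B'), hB'.symm⟩, ⟨hA, hB⟩, hcA, hcB⟩
  choose f hf hfA hfB using step
  let s : ℕ → {p : Submodule ℂ H × Submodule ℂ H // IndependentPair v p.1 p.2} := fun n =>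
    Nat.rec ⟨(⊥, ⊥), ⟨inferInstance, inferInstance, disjoint_bot_left, by simpa using hv⟩⟩ f n
  have hs : Monotone fun n => (s n).1 := monotone_nat_of_le_succ fun n => hf n (s n)
  have dense : ∀ C : ℕ →o Submodule ℂ H,
      (∀ n, ∃ c ∈ C (n + 1), ‖c - b n.unpair.1‖ < 1 / (n + 1)) →
      Dense (⋃ n, (C n : Set H)) := by
    intro C hC
    rw [← Submodule.coe_iSup_of_directed C C.monotone.directed_le,
      Submodule.dense_iff_topologicalClosure_eq_top, eq_top_iff, ← hb]
    refine Submodule.topologicalClosure_minimal _ (Submodule.span_le.2 ?_)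
      (Submodule.isClosed_topologicalClosure _)
    rintro _ ⟨k, rfl⟩
    refine Metric.mem_closure_iff.2 fun ε hε => ?_
    obtain ⟨N, hN⟩ := exists_nat_one_div_lt hε
    obtain ⟨c, hc, hcb⟩ := hC (Nat.pair k N)
    refine ⟨c, Submodule.mem_iSup_of_mem _ hc, ?_⟩
    rw [Nat.unpair_pair] at hcb
    rw [dist_comm, dist_eq_norm]
    refine hcb.trans (lt_of_le_of_lt ?_ hN)
    exact Nat.one_div_le_one_div (Nat.right_le_pair k N)
  exact ⟨⟨fun n => (s n).1.1, fun m n h => (hs h).1⟩, ⟨fun n => (s n).1.2, fun m n h => (hs h).2⟩,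
    fun n => (s n).2, dense _ fun n => hfA n (s n), dense _ fun n => hfB n (s n)⟩

end Chains

/-! ### Extension of maps from dense families -/

section Extension

lemma exists_lipschitzWith_extend {S X Y : Type*} [PseudoMetricSpace X] [MetricSpace Y]
    [CompleteSpace Y] {ι : S → X} (hι : DenseRange ι) (f : S → Y)
    (hf : ∀ a b, dist (f a) (f b) ≤ dist (ι a) (ι b)) :
    ∃ φ : X → Y, LipschitzWith 1 φ ∧ ∀ a, φ (ι a) = f a := by
  let : PseudoMetricSpace S := PseudoMetricSpace.induced ι inferInstance
  have hu : IsUniformInducing ι := ⟨rfl⟩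
  have hfu : UniformContinuous f := (LipschitzWith.of_dist_le_mul (K := 1)
    fun a b => by
      rw [NNReal.coe_one, one_mul]
      exact hf a b).uniformContinuous
  let φ := (hu.isDenseInducing hι).extend f
  have hφc : Continuous φ := (uniformContinuous_uniformly_extend hu hι hfu).continuous
  have hφ : ∀ a, φ (ι a) = f a := uniformly_extend_of_ind hu hι hfu
  refine ⟨φ, LipschitzWith.of_dist_le_mul fun x y => ?_, hφ⟩
  rw [NNReal.coe_one, one_mul]
  refine hι.induction_on₂ (p := fun x y => dist (φ x) (φ y) ≤ dist x y) ?_ ?_ x y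
  · exact isClosed_le (by fun_prop) (by fun_prop)
  · intro a b
    rw [hφ, hφ]
    exact hf a b

lemma isometry_of_denseRange {S X Y : Type*} [PseudoMetricSpace X] [PseudoMetricSpace Y]
    {ι : S → X} (hι : DenseRange ι) {φ : X → Y} (hφ : Continuous φ)
    (h : ∀ a b, dist (φ (ι a)) (φ (ι b)) = dist (ι a) (ι b)) : Isometry φ := by
  refine Isometry.of_dist_eq fun x y => ?_
  exact hι.induction_on₂ (p := fun x y => dist (φ x) (φ y) = dist x y)
    (isClosed_eq (by fun_prop) (by fun_prop)) h x y

end Extension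

/-! ### Directed colimits and jointly dense legs -/

section Colimits

lemma LinearContraction.continuous {E F : Type*} [NormedAddCommGroup E] [NormedSpace ℂ E]
    [NormedAddCommGroup F] [NormedSpace ℂ F] (f : LinearContraction E F) :
    Continuous f.toLinearMap :=
  AddMonoidHomClass.continuous_of_bound f.toLinearMap 1 (by simpa using f.norm_map_le)

variable {J : Type w₁} [PartialOrder J] {F : J ⥤ HilbR.{u}}

/-- The legs of a cocone, on the disjoint union of the spaces of the diagram. -/
def legs (c : Cocone F) (a : Σ j, (F.obj j).carrier) : c.pt.carrier :=
  (c.ι.app a.1).hom a.2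

lemma leg_map (c : Cocone F) {j k : J} (h : j ⟶ k) (x : (F.obj j).carrier) :
    (c.ι.app k).hom ((F.map h).hom x) = (c.ι.app j).hom x := by
  rw [← c.w h]
  rfl

variable [IsDirectedOrder J]

/-- Directedness moves any two elements to a common stage, so binary properties of the legs need
checking only within one space of the diagram. -/
lemma exists_common_index {p : (Σ j, (F.obj j).carrier) → (Σ j, (F.obj j).carrier) → Prop}
    (hp : ∀ j x y, p ⟨j, x⟩ ⟨j, y⟩)
    (hl : ∀ {i j k : J} (h : i ⟶ k) (h' : j ⟶ k) (x : (F.obj i).carrier) (y : (F.obj j).carrier),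
      p ⟨k, (F.map h).hom x⟩ ⟨k, (F.map h').hom y⟩ → p ⟨i, x⟩ ⟨j, y⟩)
    (a b : Σ j, (F.obj j).carrier) : p a b := by
  obtain ⟨k, hi, hj⟩ := exists_ge_ge a.1 b.1
  exact hl (homOfLE hi) (homOfLE hj) a.2 b.2 (hp _ _ _)

lemma exists_desc {c : Cocone F} (hc : DenseRange (legs c)) {Y : Type*} [MetricSpace Y]
    [CompleteSpace Y] (f : ∀ j, (F.obj j).carrier → Y)
    (hf : ∀ {j k : J} (h : j ⟶ k) (x), f k ((F.map h).hom x) = f j x)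
    (hd : ∀ j x y, dist (f j x) (f j y) ≤ dist x y) :
    ∃ φ : c.pt.carrier → Y, LipschitzWith 1 φ ∧ ∀ j x, φ ((c.ι.app j).hom x) = f j x := by
  obtain ⟨φ, hφ, h⟩ := exists_lipschitzWith_extend hc (fun a => f a.1 a.2) (by
    refine exists_common_index (fun j x y => ?_) (fun h h' x y => ?_)
    · simpa [legs] using hd j x y
    · simp only [legs, hf, leg_map]
      exact id)
  exact ⟨φ, hφ, fun j x => h ⟨j, x⟩⟩

omit [IsDirectedOrder J] in
lemma desc_unique {c : Cocone F} (hc : DenseRange (legs c)) {Y : Type*} [TopologicalSpace Y]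
    [T2Space Y] {φ ψ : c.pt.carrier → Y} (hφ : Continuous φ) (hψ : Continuous ψ)
    (h : ∀ j x, φ ((c.ι.app j).hom x) = ψ ((c.ι.app j).hom x)) : φ = ψ :=
  hc.equalizer hφ hψ (funext fun a => h a.1 a.2)

lemma isometry_desc {c : Cocone F} (hc : DenseRange (legs c)) {Y : Type*} [MetricSpace Y]
    {φ : c.pt.carrier → Y} (hφ : Continuous φ)
    (h : ∀ j, Isometry fun x => φ ((c.ι.app j).hom x)) : Isometry φ := by
  refine isometry_of_denseRange hc hφ (exists_common_index (fun j x y => ?_)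
    fun h h' x y => ?_)
  · simpa [legs] using (h j).dist_eq x y
  · simp only [legs, leg_map]
    exact id

lemma exists_linear_desc {c : Cocone F} (hc : DenseRange (legs c)) {Y : Type*}
    [NormedAddCommGroup Y] [NormedSpace ℂ Y] [CompleteSpace Y]
    (f : ∀ j, LinearContraction (F.obj j).carrier Y)
    (hf : ∀ {j k : J} (h : j ⟶ k) (x),
      (f k).toLinearMap ((F.map h).hom x) = (f j).toLinearMap x) :
    ∃ φ : LinearContraction c.pt.carrier Y,
      ∀ j x, φ.toLinearMap ((c.ι.app j).hom x) = (f j).toLinearMap x := by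
  obtain ⟨φ, hφ, h⟩ := exists_desc hc (fun j x => (f j).toLinearMap x) hf (fun j x y => by
    rw [dist_eq_norm, dist_eq_norm, ← map_sub]
    exact (f j).norm_map_le _)
  have hcont := hφ.continuous
  have hadd : ∀ x y, φ (x + y) = φ x + φ y := by
    refine fun x y => hc.induction_on₂ (p := fun x y => φ (x + y) = φ x + φ y)
      (isClosed_eq (by fun_prop) (by fun_prop)) (exists_common_index (fun j x y => ?_)
        fun h h' x y => ?_) x y
    · simp only [legs, ← map_add, h]
    · simp only [legs, leg_map]
      exact id
  have hsmul : ∀ (t : ℂ) x, φ (t • x) = t • φ x := by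
    refine fun t x => hc.induction_on (p := fun x => φ (t • x) = t • φ x) x
      (isClosed_eq (by fun_prop) (by fun_prop)) fun a => ?_
    simp only [legs, ← map_smul, h]
  let L : c.pt.carrier →ₗ[ℂ] Y := ⟨⟨φ, hadd⟩, hsmul⟩
  refine ⟨⟨L, fun x => ?_⟩, h⟩
  have h0 : φ 0 = 0 := L.map_zero
  have h1 : ‖φ x‖ ≤ ‖x‖ := by simpa [h0] using hφ.dist_le_mul x 0
  exact h1

lemma exists_linearIsometry_desc {c : Cocone F} (hc : DenseRange (legs c)) {Y : Type*}
    [NormedAddCommGroup Y] [NormedSpace ℂ Y] [CompleteSpace Y]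
    (f : ∀ j, (F.obj j).carrier →ₗᵢ[ℂ] Y)
    (hf : ∀ {j k : J} (h : j ⟶ k) (x), f k ((F.map h).hom x) = f j x) :
    ∃ φ : c.pt.carrier →ₗᵢ[ℂ] Y, ∀ j x, φ ((c.ι.app j).hom x) = f j x := by
  obtain ⟨φ, h⟩ := exists_linear_desc hc (fun j => LinearContraction.ofIsometry (f j)) hf
  have hφ : Continuous φ.toLinearMap := φ.continuous
  have hi : Isometry φ.toLinearMap := isometry_desc hc hφ fun j => by
    simp only [h]
    exact (f j).isometry
  exact ⟨⟨φ.toLinearMap, (AddMonoidHomClass.isometry_iff_norm _).1 hi⟩, h⟩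

variable {c : Cocone F}

/-- A cocone of linear isometries with jointly dense legs is a colimit of Hilbert spaces. -/
lemma nonempty_isColimit_of_denseRange (hc : DenseRange (legs c)) : Nonempty (IsColimit c) := by
  refine ⟨IsColimit.ofExistsUnique fun s => ?_⟩
  obtain ⟨φ, h⟩ := exists_linearIsometry_desc hc (Y := s.pt.carrier) (fun j => (s.ι.app j).hom) (leg_map s)
  refine ⟨⟨φ⟩, fun j => HilbR.Hom.ext (LinearIsometry.ext (h j)), fun ψ hψ => ?_⟩
  refine HilbR.Hom.ext (DFunLike.coe_injective
    (desc_unique hc ψ.hom.continuous φ.continuous fun j x => ?_))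
  exact (DFunLike.congr_fun (congrArg HilbR.Hom.hom (hψ j)) x).trans (h j x).symm

lemma nonempty_isColimit_hilbRToMetR (hc : DenseRange (legs c)) :
    Nonempty (IsColimit (hilbRToMetR.mapCocone c)) := by
  refine ⟨IsColimit.ofExistsUnique fun s => ?_⟩
  obtain ⟨φ, hφ, h⟩ := exists_desc hc (Y := s.pt.carrier) (fun j => (s.ι.app j).hom)
    (fun e x => congrFun (congrArg MetR.Hom.hom (s.w e)) x)
    (fun j x y => ((s.ι.app j).isometry.dist_eq x y).le)
  refine ⟨⟨φ, isometry_desc hc hφ.continuous fun j => ?_⟩,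
    fun j => MetR.Hom.ext (funext (h j)), fun ψ hψ => ?_⟩
  · simp only [h]
    exact (s.ι.app j).isometry
  · refine MetR.Hom.ext (desc_unique hc ψ.isometry.continuous hφ.continuous fun j x => ?_)
    exact (congrFun (congrArg MetR.Hom.hom (hψ j)) x).trans (h j x).symm

lemma nonempty_isColimit_hilbRToMet (hc : DenseRange (legs c)) :
    Nonempty (IsColimit (hilbRToMet.mapCocone c)) := by
  refine ⟨IsColimit.ofExistsUnique fun s => ?_⟩
  obtain ⟨φ, hφ, h⟩ := exists_desc hc (Y := s.pt.carrier) (fun j => (s.ι.app j).hom)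
    (fun e x => congrFun (congrArg Met.Hom.hom (s.w e)) x)
    (fun j x y => (s.ι.app j).dist_map_le x y)
  refine ⟨⟨φ, fun x y => (hφ.dist_le_mul x y).trans_eq (one_mul _)⟩,
    fun j => Met.Hom.ext (funext (h j)), fun ψ hψ => ?_⟩
  have hψc : Continuous ψ.hom := (LipschitzWith.of_dist_le_mul (K := 1)
    fun x y => by simpa using ψ.dist_map_le x y).continuous
  refine Met.Hom.ext (desc_unique hc hψc hφ.continuous fun j x => ?_)
  exact (congrFun (congrArg Met.Hom.hom (hψ j)) x).trans (h j x).symm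

lemma nonempty_isColimit_hilbRToBanR (hc : DenseRange (legs c)) :
    Nonempty (IsColimit (hilbRToBanR.mapCocone c)) := by
  refine ⟨IsColimit.ofExistsUnique fun s => ?_⟩
  obtain ⟨φ, h⟩ := exists_linearIsometry_desc hc (Y := s.pt.carrier) (fun j => (s.ι.app j).hom)
    (fun e x => DFunLike.congr_fun (congrArg BanR.Hom.hom (s.w e)) x)
  refine ⟨⟨φ⟩, fun j => BanR.Hom.ext (LinearIsometry.ext (h j)), fun ψ hψ => ?_⟩
  refine BanR.Hom.ext (DFunLike.coe_injective
    (desc_unique hc ψ.hom.continuous φ.continuous fun j x => ?_))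
  exact (DFunLike.congr_fun (congrArg BanR.Hom.hom (hψ j)) x).trans (h j x).symm

lemma nonempty_isColimit_hilbRToBan (hc : DenseRange (legs c)) :
    Nonempty (IsColimit (hilbRToBan.mapCocone c)) := by
  refine ⟨IsColimit.ofExistsUnique fun s => ?_⟩
  let f : ∀ j, LinearContraction (F.obj j).carrier s.pt.carrier := fun j => (s.ι.app j).hom
  obtain ⟨φ, h⟩ := exists_linear_desc hc f
    (fun e x => DFunLike.congr_fun
      (congrArg (fun f => (Ban.Hom.hom f).toLinearMap) (s.w e)) x)
  refine ⟨⟨φ⟩, fun j => Ban.Hom.ext (LinearContraction.ext (LinearMap.ext (h j))),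
    fun ψ hψ => ?_⟩
  refine Ban.Hom.ext (LinearContraction.ext (DFunLike.coe_injective
    (desc_unique hc ψ.hom.continuous φ.continuous fun j x => ?_)))
  exact (DFunLike.congr_fun
    (congrArg (fun f => (Ban.Hom.hom f).toLinearMap) (hψ j)) x).trans (h j x).symm

lemma nonempty_isColimit_hilbRToHilb (hc : DenseRange (legs c)) :
    Nonempty (IsColimit (hilbRToHilb.mapCocone c)) := by
  refine ⟨IsColimit.ofExistsUnique fun s => ?_⟩
  let f : ∀ j, LinearContraction (F.obj j).carrier s.pt.carrier := fun j => (s.ι.app j).hom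
  obtain ⟨φ, h⟩ := exists_linear_desc hc f
    (fun e x => DFunLike.congr_fun
      (congrArg (fun f => (Hilb.Hom.hom f).toLinearMap) (s.w e)) x)
  refine ⟨⟨φ⟩, fun j => Hilb.Hom.ext (LinearContraction.ext (LinearMap.ext (h j))),
    fun ψ hψ => ?_⟩
  refine Hilb.Hom.ext (LinearContraction.ext (DFunLike.coe_injective
    (desc_unique hc ψ.hom.continuous φ.continuous fun j x => ?_)))
  exact (DFunLike.congr_fun
    (congrArg (fun f => (Hilb.Hom.hom f).toLinearMap) (hψ j)) x).trans (h j x).symm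

/-- The legs of a directed colimit of Hilbert spaces are jointly dense. -/
lemma denseRange_legs [Nonempty J] (hc : IsColimit c) : DenseRange (legs c) := by
  let R : J → Submodule ℂ c.pt.carrier := fun j => LinearMap.range (c.ι.app j).hom.toLinearMap
  have hR : Monotone R := by
    rintro j k hjk _ ⟨x, rfl⟩
    exact ⟨(F.map (homOfLE hjk)).hom x, leg_map c (homOfLE hjk) x⟩
  let M := (⨆ j, R j).topologicalClosure
  have : CompleteSpace M := (Submodule.isClosed_topologicalClosure _).completeSpace_coe
  have hM : ∀ j x, (c.ι.app j).hom x ∈ M := fun j x =>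
    Submodule.le_topologicalClosure _ (Submodule.mem_iSup_of_mem j ⟨x, rfl⟩)
  let s : Cocone F :=
    { pt := HilbR.of M
      ι :=
        { app := fun j => ⟨⟨(c.ι.app j).hom.toLinearMap.codRestrict M (hM j),
            fun x => (c.ι.app j).hom.norm_map x⟩⟩
          naturality := fun j k h => HilbR.Hom.ext (LinearIsometry.ext fun x =>
            Subtype.ext (leg_map c h x)) } }
  let i : s.pt ⟶ c.pt := ⟨M.subtypeₗᵢ⟩
  -- The legs factor through the closed span `M` of their ranges, so the identity of the colimit
  -- does too, and `M` is everything.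
  have hi : hc.desc s ≫ i = 𝟙 _ := hc.hom_ext fun j => by
    rw [hc.fac_assoc, Category.comp_id]
    rfl
  have htop : M = ⊤ := by
    refine eq_top_iff.2 fun x _ => ?_
    have hx : ((hc.desc s).hom x : M).1 = x :=
      DFunLike.congr_fun (congrArg HilbR.Hom.hom hi) x
    rw [← hx]
    exact Subtype.property _
  have hd := Submodule.dense_iff_topologicalClosure_eq_top.2 htop
  rw [Submodule.coe_iSup_of_directed R hR.directed_le] at hd
  refine hd.mono (Set.iUnion_subset fun j => ?_)
  rintro _ ⟨x, rfl⟩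
  exact ⟨⟨j, x⟩, rfl⟩

end Colimits

/-! ### Preservation, faithfulness and transfer -/

lemma preservesDirectedColimits_of_denseRange {D : Type v₁} [Category.{w₁} D]
    {G : HilbR.{u} ⥤ D}
    (h : ∀ {J : Type u} [PartialOrder J] [IsDirectedOrder J] {F : J ⥤ HilbR.{u}} {c : Cocone F},
      DenseRange (legs c) → Nonempty (IsColimit (G.mapCocone c))) :
    PreservesDirectedColimits.{u} G :=
  fun _ _ _ _ => ⟨⟨fun hc => h (denseRange_legs hc)⟩⟩

lemma faithful_hilbRToMetR : hilbRToMetR.{u}.Faithful :=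
  ⟨fun h => HilbR.Hom.ext (DFunLike.coe_injective (congrArg MetR.Hom.hom h))⟩

lemma faithful_hilbRToMet : hilbRToMet.{u}.Faithful :=
  ⟨fun h => HilbR.Hom.ext (DFunLike.coe_injective (congrArg Met.Hom.hom h))⟩

lemma faithful_hilbRToBanR : hilbRToBanR.{u}.Faithful :=
  ⟨fun h => HilbR.Hom.ext (congrArg BanR.Hom.hom h)⟩

lemma faithful_hilbRToBan : hilbRToBan.{u}.Faithful :=
  ⟨fun h => HilbR.Hom.ext (LinearIsometry.toLinearMap_injective
    (congrArg (fun f => (Ban.Hom.hom f).toLinearMap) h))⟩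

lemma faithful_hilbRToHilb : hilbRToHilb.{u}.Faithful :=
  ⟨fun h => HilbR.Hom.ext (LinearIsometry.toLinearMap_injective
    (congrArg (fun f => (Hilb.Hom.hom f).toLinearMap) h))⟩

lemma IsFinitelyConcrete.of_faithful {K : Type v₁} [Category.{w₁} K] {L : Type v₂}
    [Category.{w₂} L] (F : K ⥤ L) (hF : F.Faithful) (hF' : PreservesDirectedColimits.{u} F)
    (hL : IsFinitelyConcrete.{u} L) : IsFinitelyConcrete.{u} K := by
  obtain ⟨U, hU, hU'⟩ := hL
  refine ⟨F ⋙ U, inferInstance, fun J _ _ _ => ?_⟩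
  have := hF' J
  have := hU' J
  infer_instance

/-! ### Supports and the action of reflections -/

section Support

variable {H : HilbR.{u}}

/-- The diagram of an increasing sequence of complete subspaces. -/
noncomputable def chainFunctor (A : ℕ →o Submodule ℂ H.carrier) [∀ n, CompleteSpace (A n)] :
    ULift.{u} ℕ ⥤ HilbR.{u} where
  obj n := HilbR.of (A n.down)
  map h := ⟨⟨Submodule.inclusion (A.monotone h.le), fun _ => rfl⟩⟩

/-- The cocone of an increasing sequence of complete subspaces over the ambient space. -/
noncomputable def chainCocone (A : ℕ →o Submodule ℂ H.carrier) [∀ n, CompleteSpace (A n)] :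
    Cocone (chainFunctor A) where
  pt := H
  ι :=
    { app := fun n => ⟨(A n.down).subtypeₗᵢ⟩
      naturality := fun _ _ _ => rfl }

lemma denseRange_legs_chainCocone (A : ℕ →o Submodule ℂ H.carrier) [∀ n, CompleteSpace (A n)]
    (hA : Dense (⋃ n, (A n : Set H.carrier))) : DenseRange (legs (chainCocone A)) :=
  hA.mono (Set.iUnion_subset fun n x hx => ⟨⟨⟨n⟩, ⟨x, hx⟩⟩, rfl⟩)

/-- An element of `U H` is fixed by all the isometries which fix pointwise a suitable member of
a given increasing sequence of subspaces with dense union. -/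
lemma exists_support {U : HilbR.{u} ⥤ Type u} (hU : PreservesDirectedColimits.{u} U)
    (A : ℕ →o Submodule ℂ H.carrier) [∀ n, CompleteSpace (A n)]
    (hA : Dense (⋃ n, (A n : Set H.carrier))) (x : U.obj H) :
    ∃ n, ∀ m, n ≤ m → ∀ g : H ⟶ H, (∀ z ∈ A m, g.hom z = z) → U.map g x = x := by
  have := hU (ULift.{u} ℕ)
  obtain ⟨hc⟩ := nonempty_isColimit_of_denseRange (denseRange_legs_chainCocone A hA)
  -- Here `x` comes from `y` at stage `n`, and an isometry fixing that stage pointwise does not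
  -- change the leg.
  obtain ⟨n, y, hy⟩ := Types.jointly_surjective_of_isColimit (isColimitOfPreserves U hc) x
  refine ⟨n.down, fun m hm g hg => ?_⟩
  have hy' : U.map ((chainCocone A).ι.app n) y = x := hy
  have hg' : (chainCocone A).ι.app n ≫ g = (chainCocone A).ι.app n :=
    HilbR.Hom.ext (LinearIsometry.ext fun z => hg _ (A.monotone hm z.2))
  have h := ConcreteCategory.congr_hom (congrArg U.map hg') y
  erw [U.map_comp] at h
  change U.map g (U.map ((chainCocone A).ι.app n) y) = U.map ((chainCocone A).ι.app n) y at h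
  rwa [hy'] at h

/-- The reflection in the orthogonal complement of `v`. -/
noncomputable def reflectionHom (v : H.carrier) : H ⟶ H :=
  ⟨(ℂ ∙ v)ᗮ.reflection.toLinearIsometry⟩

lemma reflectionHom_comp (g : H ⟶ H) (v : H.carrier) :
    g ≫ reflectionHom (g.hom v) = reflectionHom v ≫ g :=
  HilbR.Hom.ext (LinearIsometry.ext fun x => reflection_map_linearIsometry g.hom v x)

/-- If `x` is fixed by the isometries fixing `G` pointwise, then whether the reflection in the
complement of a vector fixes `x` depends only on the norm of the vector and its component
along `G`. -/
lemma map_reflectionHom_eq_of_sub_orthogonal {U : HilbR.{u} ⥤ Type u} {x : U.obj H}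
    {G : Submodule ℂ H.carrier}
    (hx : ∀ g : H ⟶ H, (∀ z ∈ G, g.hom z = z) → U.map g x = x) {p q : H.carrier}
    (hpq : ‖p‖ = ‖q‖) (ho : ∀ z ∈ G, ⟪p - q, z⟫_ℂ = 0)
    (hp : U.map (reflectionHom p) x = x) : U.map (reflectionHom q) x = x := by
  obtain ⟨g, hgp, hg⟩ := exists_linearIsometry_map_eq hpq
  let g' : H ⟶ H := ⟨g⟩
  have hgx : U.map g' x = x := hx g' fun z hz => hg z (ho z hz)
  have h := reflectionHom_comp g' p
  rw [show g'.hom p = q from hgp] at h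
  have h' := ConcreteCategory.congr_hom (congrArg U.map h) x
  rw [U.map_comp, U.map_comp] at h'
  change U.map (reflectionHom q) (U.map g' x) = U.map g' (U.map (reflectionHom p) x) at h'
  rwa [hgx, hp, hgx] at h'

/-- In an infinite-dimensional separable space, every reflection acts trivially. -/
lemma map_reflectionHom_eq {U : HilbR.{u} ⥤ Type u} (hU : PreservesDirectedColimits.{u} U)
    (hH : ¬ FiniteDimensional ℂ H.carrier) (b : ℕ → H.carrier)
    (hb : (Submodule.span ℂ (Set.range b)).topologicalClosure = ⊤) (x : U.obj H)
    {v : H.carrier} (hv : ‖v‖ = 1) : U.map (reflectionHom v) x = x := by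
  have ne_zero : ∀ {v : H.carrier}, ‖v‖ = 1 → v ≠ 0 := fun h => norm_ne_zero_iff.1 (by simp [h])
  have support : ∀ {v : H.carrier}, ‖v‖ = 1 → ∃ A B : Submodule ℂ H.carrier,
      IndependentPair v A B ∧ (∀ g : H ⟶ H, (∀ z ∈ A, g.hom z = z) → U.map g x = x) ∧
      ∀ g : H ⟶ H, (∀ z ∈ B, g.hom z = z) → U.map g x = x := by
    intro v hv
    obtain ⟨A, B, hAB, hA, hB⟩ := exists_independentPair_chains hH b hb (ne_zero hv)
    have fA := fun n => (hAB n).finite_left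
    have fB := fun n => (hAB n).finite_right
    have cA : ∀ n, CompleteSpace (A n) := fun n => FiniteDimensional.complete ℂ _
    have cB : ∀ n, CompleteSpace (B n) := fun n => FiniteDimensional.complete ℂ _
    obtain ⟨n, hn⟩ := exists_support hU A hA x
    obtain ⟨m, hm⟩ := exists_support hU B hB x
    -- Independence is known only at equal indices, so both supports are enlarged to a common stage.
    exact ⟨A (max n m), B (max n m), hAB _, hn _ (le_max_left _ _), hm _ (le_max_right _ _)⟩
  -- Real dimension greater than one makes the unit sphere connected.
  have hrank : 1 < Module.rank ℝ H.carrier := by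
    have : Nontrivial H.carrier := ⟨v, 0, ne_zero hv⟩
    rw [rank_real_of_complex]
    calc (1 : Cardinal) < 2 * 1 := by norm_num
      _ ≤ 2 * Module.rank ℂ H.carrier := by
        gcongr
        exact Cardinal.one_le_iff_ne_zero.2 rank_pos.ne'
  have local_iff : ∀ p ∈ Metric.sphere (0 : H.carrier) 1, ∀ᶠ q in 𝓝[Metric.sphere 0 1] p,
      (U.map (reflectionHom p) x = x ↔ U.map (reflectionHom q) x = x) := by
    intro p hp
    have hp1 : ‖p‖ = 1 := by simpa using hp
    obtain ⟨A, B, hAB, hA, hB⟩ := support hp1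
    have := hAB.finite_left
    have := hAB.finite_right
    filter_upwards [self_mem_nhdsWithin, nhdsWithin_le_nhds
      (eventually_exists_sub_orthogonal hAB.disjoint hAB.notMem hp1)] with q hq hq'
    have hq1 : ‖q‖ = 1 := by simpa using hq
    obtain ⟨w, hw, hpw, hwq⟩ := hq'
    refine Iff.trans (b := U.map (reflectionHom w) x = x) ⟨?_, ?_⟩ ⟨?_, ?_⟩
    · exact map_reflectionHom_eq_of_sub_orthogonal hA (hp1.trans hw.symm) hpw
    · refine map_reflectionHom_eq_of_sub_orthogonal hA (hw.trans hp1.symm) fun z hz => ?_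
      rw [← neg_sub, inner_neg_left, hpw z hz, neg_zero]
    · exact map_reflectionHom_eq_of_sub_orthogonal hB (hw.trans hq1.symm) hwq
    · refine map_reflectionHom_eq_of_sub_orthogonal hB (hq1.trans hw.symm) fun z hz => ?_
      rw [← neg_sub, inner_neg_left, hwq z hz, neg_zero]
  obtain ⟨A, B, hAB, hA, -⟩ := support hv
  have := hAB.finite_left
  have hne : A ≠ ⊤ := fun e => hAB.notMem (Submodule.mem_sup_left (e ▸ Submodule.mem_top))
  -- Starting point for the connectedness argument: the reflection negating a unit vector orthogonal
  -- to the support `A` fixes `A` pointwise, hence fixes `x`.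
  obtain ⟨z, hz, hz0⟩ := Submodule.exists_mem_ne_zero_of_ne_bot
    (mt Submodule.orthogonal_eq_bot_iff.1 hne)
  let p : H.carrier := ((‖z‖⁻¹ : ℝ) : ℂ) • z
  have hp1 : ‖p‖ = 1 := by
    rw [norm_smul, Complex.norm_real, norm_inv, norm_norm,
      inv_mul_cancel₀ (norm_ne_zero_iff.2 hz0)]
  have hpA : p ∈ Aᗮ := Aᗮ.smul_mem _ hz
  have hp : U.map (reflectionHom p) x = x := hA _ fun y hy => by
    refine Submodule.reflection_mem_subspace_eq_self ?_
    rw [Submodule.mem_orthogonal_singleton_iff_inner_right]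
    exact Submodule.inner_left_of_mem_orthogonal hy hpA
  refine ((isPreconnected_sphere hrank 0 1).induction₂
    (fun p q => U.map (reflectionHom p) x = x ↔ U.map (reflectionHom q) x = x)
    local_iff (fun p q r _ _ _ => Iff.trans) (fun p q _ _ => Iff.symm)
    (by simpa using hp1) (by simpa using hv)).1 hp

end Support

/-- The category of Hilbert spaces and linear isometries is not finitely concrete. -/
theorem not_isFinitelyConcrete_hilbR : ¬ IsFinitelyConcrete.{u} HilbR.{u} := by
  rintro ⟨U, hU, hU'⟩
  let E := lp (fun _ : ULift.{u} ℕ => ℂ) 2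
  let B : HilbertBasis (ULift.{u} ℕ) ℂ E := ⟨LinearIsometryEquiv.refl ℂ E⟩
  let H : HilbR.{u} := HilbR.of E
  have hH : ¬ FiniteDimensional ℂ E := fun _ =>
    not_finite_iff_infinite.2 inferInstance
      (B.orthonormal.linearIndependent.finite : Finite (ULift.{u} ℕ))
  have hb : (Submodule.span ℂ (Set.range fun n : ℕ => B ⟨n⟩)).topologicalClosure = ⊤ := by
    rw [← B.dense_span, ← Equiv.ulift.symm.surjective.range_comp B]
    rfl
  let v : H.carrier := B ⟨0⟩
  have hv : ‖v‖ = 1 := B.orthonormal.1 _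
  have h : reflectionHom v = 𝟙 H := U.map_injective <| by
    ext x
    rw [U.map_id]
    exact map_reflectionHom_eq hU' hH _ hb x hv
  -- Faithfulness has made the reflection the identity, yet it sends the unit vector `v` to `-v`.
  have h' : (ℂ ∙ v)ᗮ.reflection v = v :=
    DFunLike.congr_fun (congrArg HilbR.Hom.hom h) v
  rw [Submodule.reflection_orthogonalComplement_singleton_eq_neg] at h'
  have h2 : (2 : ℂ) • v = 0 := by
    rw [two_smul]
    nth_rw 1 [← h']
    exact neg_add_cancel v
  simp [(smul_eq_zero.1 h2).resolve_left two_ne_zero] at hv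

end FiniteConcreteness

theorem mainTheorem2 :
    -- none of the five categories is finitely concrete
    (¬ FiniteConcreteness.IsFinitelyConcrete.{u} FiniteConcreteness.MetR.{u} ∧
      ¬ FiniteConcreteness.IsFinitelyConcrete.{u} FiniteConcreteness.BanR.{u} ∧
      ¬ FiniteConcreteness.IsFinitelyConcrete.{u} FiniteConcreteness.Hilb.{u} ∧
      ¬ FiniteConcreteness.IsFinitelyConcrete.{u} FiniteConcreteness.Met.{u} ∧
      ¬ FiniteConcreteness.IsFinitelyConcrete.{u} FiniteConcreteness.Ban.{u}) ∧
    -- the natural inclusions of `Hilb_r` are faithful and preserve directed colimits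
    ((FiniteConcreteness.hilbRToMetR.{u}.Faithful ∧
        FiniteConcreteness.PreservesDirectedColimits.{u} FiniteConcreteness.hilbRToMetR.{u}) ∧
      (FiniteConcreteness.hilbRToBanR.{u}.Faithful ∧
        FiniteConcreteness.PreservesDirectedColimits.{u} FiniteConcreteness.hilbRToBanR.{u}) ∧
      (FiniteConcreteness.hilbRToHilb.{u}.Faithful ∧
        FiniteConcreteness.PreservesDirectedColimits.{u} FiniteConcreteness.hilbRToHilb.{u}) ∧
      (FiniteConcreteness.hilbRToMet.{u}.Faithful ∧
        FiniteConcreteness.PreservesDirectedColimits.{u} FiniteConcreteness.hilbRToMet.{u}) ∧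
      (FiniteConcreteness.hilbRToBan.{u}.Faithful ∧
        FiniteConcreteness.PreservesDirectedColimits.{u} FiniteConcreteness.hilbRToBan.{u})) ∧
    -- a faithful functor preserving directed colimits transfers non-finite concreteness
    (∀ (K : Type v₁) [Category.{w₁} K] (L : Type v₂) [Category.{w₂} L] (F : K ⥤ L),
      F.Faithful → FiniteConcreteness.PreservesDirectedColimits.{u} F →
      ¬ FiniteConcreteness.IsFinitelyConcrete.{u} K →
      ¬ FiniteConcreteness.IsFinitelyConcrete.{u} L) := by
  open FiniteConcreteness in
  have metR : hilbRToMetR.{u}.Faithful ∧ PreservesDirectedColimits.{u} hilbRToMetR.{u} :=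
    ⟨faithful_hilbRToMetR,
      preservesDirectedColimits_of_denseRange nonempty_isColimit_hilbRToMetR⟩
  have banR : hilbRToBanR.{u}.Faithful ∧ PreservesDirectedColimits.{u} hilbRToBanR.{u} :=
    ⟨faithful_hilbRToBanR,
      preservesDirectedColimits_of_denseRange nonempty_isColimit_hilbRToBanR⟩
  have hilb : hilbRToHilb.{u}.Faithful ∧ PreservesDirectedColimits.{u} hilbRToHilb.{u} :=
    ⟨faithful_hilbRToHilb,
      preservesDirectedColimits_of_denseRange nonempty_isColimit_hilbRToHilb⟩
  have met : hilbRToMet.{u}.Faithful ∧ PreservesDirectedColimits.{u} hilbRToMet.{u} :=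
    ⟨faithful_hilbRToMet,
      preservesDirectedColimits_of_denseRange nonempty_isColimit_hilbRToMet⟩
  have ban : hilbRToBan.{u}.Faithful ∧ PreservesDirectedColimits.{u} hilbRToBan.{u} :=
    ⟨faithful_hilbRToBan,
      preservesDirectedColimits_of_denseRange nonempty_isColimit_hilbRToBan⟩
  have key : ¬ IsFinitelyConcrete.{u} HilbR.{u} := not_isFinitelyConcrete_hilbR
  exact ⟨⟨mt (.of_faithful _ metR.1 metR.2) key, mt (.of_faithful _ banR.1 banR.2) key,
      mt (.of_faithful _ hilb.1 hilb.2) key, mt (.of_faithful _ met.1 met.2) key,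
      mt (.of_faithful _ ban.1 ban.2) key⟩, ⟨metR, banR, hilb, met, ban⟩,
    fun K _ L _ F hF hF' => mt (.of_faithful F hF hF')⟩
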